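/- Let $\mathcal H=\bigotimes_{j=1}^{n}\mathcal H_j$ be a tensor product of finite-dimensional complex Hilbert spaces (identified, by a choice of orthonormal bases, with $\mathcal H_j=\mathbb C^{d_j}$). A pure state is a unit vector of $\mathcal H$; it is separable if it is of the form $\bigotimes_{j}|\phi^{(j)}\rangle$ with unit vectors $|\phi^{(j)}\rangle\in\mathcal H_j$. A mixed state is a positive semidefinite operator of trace one on $\mathcal H$. Let $S$ be the set of separable mixed states, that is, of the finite convex combinations $\sigma=\sum_i p_i|\phi_i\rangle\langle\phi_i|$ with separable pure states $|\phi_i\rangle$. Let $F(\rho,\sigma)=\bigl(\mathrm{Tr}\sqrt{\sqrt\rho\,\sigma\sqrt\rho}\bigr)^2$ be Uhlmann's fidelity. For a pure state $|\psi\rangle$ put $$E_G(|\psi\rangle)=1-\max_{|\phi\rangle\ \text{separable}}|\langle\phi|\psi\rangle|^2,$$ and for a mixed state $\rho$ let $E_G(\rho)$ be the convex roof $$E_G(\rho)=\min\sum_i p_iE_G(|\psi_i\rangle),$$ the minimum being taken over all finite pure state decompositions $\rho=\sum_i p_i|\psi_i\rangle\langle\psi_i|$ ($p_i\ge 0$,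 $\sum_i p_i=1$, $|\psi_i\rangle$ unit vectors). Then for every mixed state $\rho$ on $\mathcal H$ these maxima and minima, and the maximum of $F(\rho,\sigma)$ over $\sigma\in S$, are attained, and $$E_G(\rho)=1-\max_{\sigma\in S}F(\rho,\sigma).$$ -/

import Mathlib

noncomputable section

namespace Entanglement

open scoped ComplexOrder MatrixOrder

/-- Labels of the product basis of `ℋ = ⨂ⱼ ℂ^{dⱼ}`, the composite of `n` parties. -/
abbrev Idx {n : ℕ} (d : Fin n → ℕ) : Type := (j : Fin n) → Fin (d j)

/-- The Hilbert space `ℋ = ⨂ⱼ ℂ^{dⱼ}`, written in the orthonormal product basis. -/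
abbrev Ket {n : ℕ} (d : Fin n → ℕ) : Type := EuclideanSpace ℂ (Idx d)

/-- Linear operators on `ℋ = ⨂ⱼ ℂ^{dⱼ}`, as matrices in the product basis. -/
abbrev Op {n : ℕ} (d : Fin n → ℕ) : Type := Matrix (Idx d) (Idx d) ℂ

variable {n : ℕ} {d : Fin n → ℕ}

/-- A mixed state (density operator): positive semidefinite of trace one. -/
def IsState (ρ : Op d) : Prop := ρ.PosSemidef ∧ ρ.trace = 1

/-- The operator `|ψ⟩⟨ψ|`. -/
def proj (ψ : Ket d) : Op d := Matrix.vecMulVec ψ.ofLp (star ψ.ofLp)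

/-- The elementary tensor `⨂ⱼ |φ⁽ʲ⁾⟩`. -/
def tensorKet (φ : (j : Fin n) → EuclideanSpace ℂ (Fin (d j))) : Ket d :=
  WithLp.toLp 2 fun x => ∏ j, φ j (x j)

/-- A separable (product) pure state: a tensor product of unit vectors. -/
def IsProductKet (φ : Ket d) : Prop :=
  ∃ χ : (j : Fin n) → EuclideanSpace ℂ (Fin (d j)), (∀ j, ‖χ j‖ = 1) ∧ φ = tensorKet χ

/-- `{pᵢ, |ψᵢ⟩}` is a pure state decomposition of `ρ`: the `pᵢ` are probabilities, the `ψᵢ` are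
unit vectors, and `ρ = ∑ᵢ pᵢ |ψᵢ⟩⟨ψᵢ|`. -/
def IsPureDecomposition (ρ : Op d) {k : ℕ} (p : Fin k → ℝ) (ψ : Fin k → Ket d) : Prop :=
  (∀ i, 0 ≤ p i) ∧ ∑ i, p i = 1 ∧ (∀ i, ‖ψ i‖ = 1) ∧ ρ = ∑ i, (p i : ℂ) • proj (ψ i)

/-- A separable mixed state: a convex combination of projectors onto product pure states. -/
def IsSeparable (σ : Op d) : Prop :=
  ∃ (k : ℕ) (p : Fin k → ℝ) (φ : Fin k → Ket d),
    IsPureDecomposition σ p φ ∧ ∀ i, IsProductKet (φ i)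

/-- Uhlmann's fidelity `F(ρ, σ) = (Tr √(√ρ σ √ρ))²`. -/
def fidelity (ρ σ : Op d) : ℝ :=
  (CFC.sqrt (CFC.sqrt ρ * σ * CFC.sqrt ρ)).trace.re ^ 2

/-- The values `|⟨φ|ψ⟩|²`, where `φ` runs over the separable pure states. -/
def productOverlaps (ψ : Ket d) : Set ℝ :=
  {x | ∃ φ : Ket d, IsProductKet φ ∧ x = ‖inner ℂ φ ψ‖ ^ 2}

/-- The geometric measure of entanglement of a pure state,
`E_G(ψ) = 1 - max_φ |⟨φ|ψ⟩|²` over the separable pure states `φ`. -/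
def geometricPure (ψ : Ket d) : ℝ := 1 - sSup (productOverlaps ψ)

/-- The averages `∑ᵢ pᵢ E_G(ψᵢ)` over the pure state decompositions of `ρ`. -/
def convexRoofValues (ρ : Op d) : Set ℝ :=
  {x | ∃ (k : ℕ) (p : Fin k → ℝ) (ψ : Fin k → Ket d),
    IsPureDecomposition ρ p ψ ∧ x = ∑ i, p i * geometricPure (ψ i)}

/-- The geometric measure of entanglement of a mixed state, as a convex roof. -/
def geometricMeasure (ρ : Op d) : ℝ := sInf (convexRoofValues ρ)

/-- The fidelities of `ρ` with the separable states. -/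
def separableFidelities (ρ : Op d) : Set ℝ :=
  {x | ∃ σ : Op d, IsSeparable σ ∧ x = fidelity ρ σ}

end Entanglement

end

noncomputable section
namespace Entanglement
open scoped ComplexOrder MatrixOrder Matrix

/-! ### Polar decomposition and Uhlmann's theorem for matrices. -/

variable {m k : Type*} [Fintype m] [DecidableEq m] [Fintype k]

/-! Both sides are compared with one set, `averageOverlaps ρ`: the numbers `∑ pᵢ |⟨φᵢ|ψᵢ⟩|²` over
decompositions of `ρ` and product kets `φᵢ`. It is a slice of the convex hull of a compact set,
hence compact, and so has a greatest element `y`. Choosing the best `φᵢ` for each `ψᵢ` shows that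
the least convex roof value is `1 - y`.

That `y` is also the greatest fidelity comes from Uhlmann's theorem, with `ρ = A Aᴴ` and `σ = B Bᴴ`
written through matrices of weighted kets, so that `Tr (B Aᴴ) = ∑ ⟨aᵢ|bᵢ⟩`. Cauchy–Schwarz bounds
`F(ρ, σ)` by an average overlap (`exists_averageOverlap_ge`); conversely, weights that make
Cauchy–Schwarz an equality give a separable `σ` with fidelity at least the given average
(`exists_fidelity_ge`). -/

theorem sqrt_posSemidef (A : Matrix m m ℂ) : (CFC.sqrt A).PosSemidef :=
  Matrix.nonneg_iff_posSemidef.mp (CFC.sqrt_nonneg A)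

theorem sqrt_mul_sqrt {A : Matrix m m ℂ} (hA : A.PosSemidef) : CFC.sqrt A * CFC.sqrt A = A :=
  CFC.sqrt_mul_sqrt_self A (Matrix.nonneg_iff_posSemidef.mpr hA)

/-- A Hermitian matrix has a Hermitian commuting pseudo-inverse. -/
theorem exists_pseudoInverse {R : Matrix m m ℂ} (hR : R.IsHermitian) :
    ∃ J : Matrix m m ℂ, J.IsHermitian ∧ R * J = J * R ∧ R * J * R = R := by
  have hsa : IsSelfAdjoint R := hR
  have hc (f : ℝ → ℝ) : ContinuousOn f (spectrum ℝ R) :=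
    R.finite_real_spectrum.continuousOn f
  have hid : cfc (fun x : ℝ => x) R = R := cfc_id' ℝ R
  -- Since `0⁻¹ = 0`, the identity `x * x⁻¹ * x = x` holds on the whole spectrum.
  refine ⟨cfc (fun x : ℝ => x⁻¹) R, cfc_predicate _ _, ?_, ?_⟩
  · conv_lhs => rw [← hid]
    conv_rhs => rw [← hid]
    rw [hid]
    conv_lhs => arg 1; rw [← hid]
    conv_rhs => arg 2; rw [← hid]
    rw [← cfc_mul _ _ R (hc _) (hc _), ← cfc_mul _ _ R (hc _) (hc _)]
    simp only [mul_comm]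
  · conv_lhs => arg 1; arg 1; rw [← hid]
    conv_lhs => arg 2; rw [← hid]
    rw [← cfc_mul _ _ R (hc _) (hc _), ← cfc_mul _ _ R (hc _) (hc _)]
    simp only [mul_inv_mul_cancel]
    exact hid

/-- Polar decomposition `M = R U`, with a contraction `U`. -/
theorem exists_polar {M : Matrix m k ℂ} {R : Matrix m m ℂ} (hR : R.PosSemidef)
    (h : R * R = M * Mᴴ) :
    ∃ U : Matrix m k ℂ, M = R * U ∧ (1 - U * Uᴴ).PosSemidef ∧ M * Uᴴ = R := by
  obtain ⟨J, hJ, hcomm, hRJR⟩ := exists_pseudoInverse hR.1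
  have hRh : Rᴴ = R := hR.1
  have hJh : Jᴴ = J := hJ
  have hU : (J * M) * (J * M)ᴴ = R * J := by
    calc (J * M) * (J * M)ᴴ = J * (M * Mᴴ) * J := by
          rw [Matrix.conjTranspose_mul, hJh]; simp only [Matrix.mul_assoc]
      _ = J * R * (R * J) := by rw [← h]; simp only [Matrix.mul_assoc]
      _ = R * J * R * J := by rw [← hcomm]; simp only [Matrix.mul_assoc]
      _ = R * J := by rw [hRJR]
  have hQ : R * J * (R * J) = R * J := by rw [← Matrix.mul_assoc, hRJR]
  have hQh : (1 - R * J)ᴴ = 1 - R * J := by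
    rw [Matrix.conjTranspose_sub, Matrix.conjTranspose_mul, hJh, hRh, Matrix.conjTranspose_one,
      hcomm]
  refine ⟨J * M, ?_, ?_, ?_⟩
  -- `1 - R * J` is the projection that kills `R`; it kills `M` too because `M * Mᴴ = R * R`.
  · have h0 : ((1 - R * J) * M) * ((1 - R * J) * M)ᴴ = 0 := by
      calc ((1 - R * J) * M) * ((1 - R * J) * M)ᴴ
          = (1 - R * J) * (M * Mᴴ) * (1 - R * J) := by
            rw [Matrix.conjTranspose_mul, hQh]; simp only [Matrix.mul_assoc]
        _ = ((1 - R * J) * R) * (R * (1 - R * J)) := by rw [← h]; simp only [Matrix.mul_assoc]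
        _ = 0 := by rw [Matrix.sub_mul, hRJR, Matrix.one_mul, sub_self, Matrix.zero_mul]
    have h1 := Matrix.self_mul_conjTranspose_eq_zero.mp h0
    rw [Matrix.sub_mul, Matrix.one_mul, sub_eq_zero] at h1
    rw [← Matrix.mul_assoc]; exact h1
  · rw [hU]
    have : 1 - R * J = (1 - R * J)ᴴ * (1 - R * J) := by
      rw [hQh, Matrix.mul_sub, Matrix.sub_mul, Matrix.sub_mul, hQ]; simp
    rw [this]
    exact Matrix.posSemidef_conjTranspose_mul_self _
  · rw [Matrix.conjTranspose_mul, hJh, ← Matrix.mul_assoc, ← h, Matrix.mul_assoc, hcomm,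
      ← Matrix.mul_assoc, hRJR]

theorem two_mul_re_trace_le {m k : Type*} [Fintype m] [Fintype k] (X Y : Matrix m k ℂ) :
    2 * (X * Yᴴ).trace.re ≤ (X * Xᴴ).trace.re + (Y * Yᴴ).trace.re := by
  have h := (Complex.le_def.mp (Matrix.posSemidef_self_mul_conjTranspose (X - Y)).trace_nonneg).1
  have hs : (Y * Xᴴ).trace.re = (X * Yᴴ).trace.re := by
    rw [← Complex.conj_re, ← Complex.star_def, ← Matrix.trace_conjTranspose,
      Matrix.conjTranspose_mul, Matrix.conjTranspose_conjTranspose]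
  simp only [Matrix.conjTranspose_sub, Matrix.sub_mul, Matrix.mul_sub, Matrix.trace_sub,
    Complex.sub_re, Complex.zero_re, hs] at h
  linarith

/-- Compressing a contraction does not increase the trace. -/
theorem re_trace_compress_le {S : Matrix m m ℂ} (hS : S.IsHermitian) {U : Matrix m k ℂ}
    (hU : (1 - U * Uᴴ).PosSemidef) : ((S * U) * (S * U)ᴴ).trace.re ≤ (S * S).trace.re := by
  have hSh : Sᴴ = S := hS
  have h := (Complex.le_def.mp (hU.mul_mul_conjTranspose_same S).trace_nonneg).1
  rw [Matrix.mul_sub, Matrix.sub_mul, Matrix.trace_sub, Complex.sub_re, hSh, Matrix.mul_one,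
    Complex.zero_re] at h
  rw [Matrix.conjTranspose_mul, hSh]
  simp only [Matrix.mul_assoc] at h ⊢
  linarith

/-- Splitting `R` as `√R √R` turns the left side into a Hilbert–Schmidt product of `√R V` and `√R
U`, whose squared norms are at most `Tr R`. -/
theorem re_trace_mul_contractions_le {R : Matrix m m ℂ} (hR : R.PosSemidef) {U V : Matrix m k ℂ}
    (hU : (1 - U * Uᴴ).PosSemidef) (hV : (1 - V * Vᴴ).PosSemidef) :
    (R * V * Uᴴ).trace.re ≤ R.trace.re := by
  have hS := (sqrt_posSemidef R).1
  have hSh : (CFC.sqrt R)ᴴ = CFC.sqrt R := hS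
  have h := two_mul_re_trace_le (CFC.sqrt R * V) (CFC.sqrt R * U)
  have h1 := re_trace_compress_le hS hU
  have h2 := re_trace_compress_le hS hV
  rw [sqrt_mul_sqrt hR] at h1 h2
  have h3 : ((CFC.sqrt R * V) * (CFC.sqrt R * U)ᴴ).trace = (R * V * Uᴴ).trace := by
    rw [Matrix.conjTranspose_mul, hSh, ← Matrix.mul_assoc, Matrix.trace_mul_comm,
      ← Matrix.mul_assoc, ← Matrix.mul_assoc, sqrt_mul_sqrt hR]
  rw [h3] at h
  linarith

theorem sandwich_eq {ρ : Matrix m m ℂ} (B : Matrix m k ℂ) :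
    CFC.sqrt ρ * (B * Bᴴ) * CFC.sqrt ρ = (CFC.sqrt ρ * B) * (CFC.sqrt ρ * B)ᴴ := by
  have hSh : (CFC.sqrt ρ)ᴴ = CFC.sqrt ρ := (sqrt_posSemidef ρ).1
  rw [Matrix.conjTranspose_mul, hSh]; simp only [Matrix.mul_assoc]

/-- Half of Uhlmann's theorem: overlaps of purifications are bounded by the root fidelity. -/
theorem re_trace_le_trace_sqrt (A B : Matrix m k ℂ) :
    (B * Aᴴ).trace.re ≤
      (CFC.sqrt (CFC.sqrt (A * Aᴴ) * (B * Bᴴ) * CFC.sqrt (A * Aᴴ))).trace.re := by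
  set ρ := A * Aᴴ with hρdef
  have hρ : ρ.PosSemidef := Matrix.posSemidef_self_mul_conjTranspose A
  obtain ⟨U, hAU, hU, -⟩ := exists_polar (sqrt_posSemidef ρ) (sqrt_mul_sqrt hρ)
  have hSh : (CFC.sqrt ρ)ᴴ = CFC.sqrt ρ := (sqrt_posSemidef ρ).1
  rw [sandwich_eq]
  obtain ⟨V, hMV, hV, -⟩ := exists_polar (sqrt_posSemidef _)
    (sqrt_mul_sqrt (Matrix.posSemidef_self_mul_conjTranspose (CFC.sqrt ρ * B)))
  have h := re_trace_mul_contractions_le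
    (sqrt_posSemidef ((CFC.sqrt ρ * B) * (CFC.sqrt ρ * B)ᴴ)) hU hV
  rw [← hMV] at h
  have h1 : (B * Aᴴ).trace = (CFC.sqrt ρ * B * Uᴴ).trace := by
    conv_lhs => rw [hAU]
    rw [Matrix.conjTranspose_mul, hSh, ← Matrix.mul_assoc, Matrix.trace_mul_comm,
      ← Matrix.mul_assoc]
  rw [h1]; exact h

/-- The other half of Uhlmann's theorem: the root fidelity is an overlap of a purification
of `σ = B Bᴴ` with a subnormalised purification of `ρ`. -/
theorem exists_trace_eq_trace_sqrt {ρ : Matrix m m ℂ} (hρ : ρ.PosSemidef) (B : Matrix m k ℂ) :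
    ∃ (A : Matrix m k ℂ) (C : Matrix m m ℂ), ρ = A * Aᴴ + C * Cᴴ ∧
      (B * Aᴴ).trace = (CFC.sqrt (CFC.sqrt ρ * (B * Bᴴ) * CFC.sqrt ρ)).trace := by
  have hSh : (CFC.sqrt ρ)ᴴ = CFC.sqrt ρ := (sqrt_posSemidef ρ).1
  rw [sandwich_eq]
  obtain ⟨U, -, hU, hMU⟩ := exists_polar (sqrt_posSemidef _)
    (sqrt_mul_sqrt (Matrix.posSemidef_self_mul_conjTranspose (CFC.sqrt ρ * B)))
  -- `U` is only a contraction; `D` supplies the part of `ρ` that `√ρ U` misses.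
  set D := CFC.sqrt (1 - U * Uᴴ)
  have hDh : Dᴴ = D := (sqrt_posSemidef _).1
  have hD : D * D = 1 - U * Uᴴ := sqrt_mul_sqrt hU
  refine ⟨CFC.sqrt ρ * U, CFC.sqrt ρ * D, ?_, ?_⟩
  · calc ρ = CFC.sqrt ρ * (U * Uᴴ + D * D) * CFC.sqrt ρ := by
          rw [hD, add_sub_cancel, Matrix.mul_one, sqrt_mul_sqrt hρ]
      _ = _ := by
          rw [Matrix.conjTranspose_mul, Matrix.conjTranspose_mul, hSh, hDh, Matrix.mul_add,
            Matrix.add_mul]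
          simp only [Matrix.mul_assoc]
  · rw [← hMU, Matrix.conjTranspose_mul, hSh, ← Matrix.mul_assoc, Matrix.trace_mul_comm,
      ← Matrix.mul_assoc]

/-! ### Compactness of convex hulls. -/

/-- In finite dimension, the convex hull of a compact set is compact. -/
theorem isCompact_convexHull {E : Type*} [AddCommGroup E] [Module ℝ E] [TopologicalSpace E]
    [IsTopologicalAddGroup E] [ContinuousSMul ℝ E] [FiniteDimensional ℝ E] {s : Set E}
    (hs : IsCompact s) : IsCompact (convexHull ℝ s) := by
  rcases s.eq_empty_or_nonempty with rfl | ⟨s₀, hs₀⟩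
  · simp
  set N := Module.finrank ℝ E + 1
  have hcomp : IsCompact ((fun q : (Fin N → ℝ) × (Fin N → E) => ∑ i, q.1 i • q.2 i) ''
      (stdSimplex ℝ (Fin N) ×ˢ Set.univ.pi fun _ => s)) := by
    refine ((isCompact_stdSimplex ℝ (Fin N)).prod (isCompact_univ_pi fun _ => hs)).image ?_
    fun_prop
  convert hcomp using 1
  apply Set.Subset.antisymm
  · intro x hx
    obtain ⟨ι, _, z, w, hz, haff, hw, hw1, rfl⟩ := eq_pos_convex_span_of_mem_convexHull hx
    have hcard : Fintype.card ι ≤ Fintype.card (Fin N) := by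
      rw [Fintype.card_fin]
      exact haff.card_le_finrank_succ.trans
        (Nat.succ_le_succ (Submodule.finrank_le _))
    obtain ⟨e⟩ := Function.Embedding.nonempty_of_card_le hcard
    have hout (i : Fin N) (hi : i ∉ Set.range e) : Function.extend e w 0 i = 0 :=
      Function.extend_apply' _ _ _ (by simpa using hi)
    -- Carathéodory bounds the number of points by `N`; the unused slots are padded with weight `0`
    -- and the point `s₀`.
    refine ⟨(Function.extend e w 0, Function.extend e z fun _ => s₀), ⟨⟨fun i => ?_, ?_⟩,
      fun i _ => ?_⟩, ?_⟩
    · by_cases hi : i ∈ Set.range e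
      · obtain ⟨j, rfl⟩ := hi
        simpa [e.injective.extend_apply] using (hw j).le
      · exact (hout i hi).ge
    · rw [← hw1]
      exact (Fintype.sum_of_injective e e.injective _ _ hout
        fun i => (e.injective.extend_apply _ _ _).symm).symm
    · by_cases hi : i ∈ Set.range e
      · obtain ⟨j, rfl⟩ := hi
        simpa [e.injective.extend_apply] using hz ⟨j, rfl⟩
      · change Function.extend e z (fun _ => s₀) i ∈ s
        rw [Function.extend_apply' _ _ _ (by simpa using hi)]
        exact hs₀
    · refine (Fintype.sum_of_injective e e.injective _ _ (fun i hi => ?_) fun i => ?_).symm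
      · simp only [hout i hi, zero_smul]
      · simp only [e.injective.extend_apply]
  · rintro _ ⟨⟨w, z⟩, ⟨hw, hz⟩, rfl⟩
    exact mem_convexHull_of_exists_fintype w z hw.1 hw.2 (fun i => hz i trivial) rfl

/-! ### Families of kets as matrices, and product kets. -/

variable {n : ℕ} {d : Fin n → ℕ} {ι : Type*} [Fintype ι]

/-- The matrix whose columns are the given vectors. -/
def colMatrix (a : ι → Ket d) : Matrix (Idx d) ι ℂ := Matrix.of fun x i => a i x

theorem proj_apply (ψ : Ket d) (x y : Idx d) : proj ψ x y = ψ x * star (ψ y) := rfl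

theorem colMatrix_mul_conjTranspose (a : ι → Ket d) :
    colMatrix a * (colMatrix a)ᴴ = ∑ i, proj (a i) := by
  ext x y
  simp [Matrix.mul_apply, Matrix.sum_apply, colMatrix, proj_apply]

theorem trace_colMatrix_mul (a b : ι → Ket d) :
    (colMatrix b * (colMatrix a)ᴴ).trace = ∑ i, inner ℂ (a i) (b i) := by
  simp only [Matrix.trace, Matrix.diag_apply, Matrix.mul_apply, PiLp.inner_apply]
  rw [Finset.sum_comm]
  simp [colMatrix]

theorem trace_proj (ψ : Ket d) : (proj ψ).trace = (‖ψ‖ ^ 2 : ℝ) := by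
  have h := trace_colMatrix_mul (ι := Unit) (fun _ => ψ) (fun _ => ψ)
  rw [colMatrix_mul_conjTranspose] at h
  simpa [inner_self_eq_norm_sq_to_K] using h

theorem proj_smul (c : ℂ) (ψ : Ket d) : proj (c • ψ) = ((‖c‖ ^ 2 : ℝ) : ℂ) • proj ψ := by
  ext x y
  have : ((‖c‖ ^ 2 : ℝ) : ℂ) = c * star c := by
    rw [Complex.star_def, Complex.mul_conj']; push_cast; rfl
  rw [Matrix.smul_apply, this]
  simp only [proj_apply, PiLp.smul_apply, smul_eq_mul, star_mul']
  ring

theorem IsProductKet.norm_eq_one {φ : Ket d} (h : IsProductKet φ) : ‖φ‖ = 1 := by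
  obtain ⟨χ, hχ, rfl⟩ := h
  have hsq : ‖tensorKet χ‖ ^ 2 = 1 := by
    rw [EuclideanSpace.norm_sq_eq]
    simp only [tensorKet, norm_prod, ← Finset.prod_pow]
    rw [← Fintype.prod_sum (f := fun j (i : Fin (d j)) => ‖χ j i‖ ^ 2)]
    refine Finset.prod_eq_one fun j _ => ?_
    rw [← EuclideanSpace.norm_sq_eq, hχ, one_pow]
  exact (pow_eq_one_iff_of_nonneg (norm_nonneg _) two_ne_zero).mp hsq

theorem exists_isProductKet (h : Nonempty (Idx d)) : ∃ φ : Ket d, IsProductKet φ := by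
  obtain ⟨x⟩ := h
  exact ⟨_, fun j => EuclideanSpace.single (x j) 1, fun j => by simp, rfl⟩

theorem isCompact_setOf_isProductKet : IsCompact {φ : Ket d | IsProductKet φ} := by
  have h : IsCompact (tensorKet ''
      (Set.univ.pi fun j => Metric.sphere (0 : EuclideanSpace ℂ (Fin (d j))) 1)) := by
    refine (isCompact_univ_pi fun j => isCompact_sphere _ _).image ?_
    exact (PiLp.continuous_toLp 2 _).comp (by fun_prop)
  convert h using 1
  ext φ
  constructor
  · rintro ⟨χ, hχ, rfl⟩
    exact ⟨χ, by simpa using hχ, rfl⟩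
  · rintro ⟨χ, hχ, rfl⟩
    exact ⟨χ, by simpa using hχ, rfl⟩

theorem isGreatest_productOverlaps {ψ : Ket d} (hψ : ‖ψ‖ = 1) :
    IsGreatest (productOverlaps ψ) (sSup (productOverlaps ψ)) := by
  have hne : Nonempty (Idx d) := by
    by_contra h
    rw [not_nonempty_iff] at h
    rw [Subsingleton.elim ψ 0, norm_zero] at hψ
    exact zero_ne_one hψ
  have heq : productOverlaps ψ = (fun φ => ‖inner ℂ φ ψ‖ ^ 2) '' {φ : Ket d | IsProductKet φ} := by
    ext x
    simp only [productOverlaps, Set.mem_ofPred_eq, Set.mem_image, eq_comm]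
  have hc : IsCompact (productOverlaps ψ) := by
    rw [heq]
    exact isCompact_setOf_isProductKet.image (by fun_prop)
  exact hc.isGreatest_sSup (heq ▸ Set.Nonempty.image _ (exists_isProductKet hne))

/-! ### Average overlaps as a slice of a convex hull. -/

/-- The pairs of a pure state and one of its product overlaps. -/
def overlapPairs (d : Fin n → ℕ) : Set (Op d × ℝ) :=
  (fun q : Ket d × Ket d => (proj q.1, ‖inner ℂ q.2 q.1‖ ^ 2)) ''
    (Metric.sphere 0 1 ×ˢ {φ | IsProductKet φ})

theorem isCompact_overlapPairs : IsCompact (overlapPairs d) := by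
  refine ((isCompact_sphere _ _).prod isCompact_setOf_isProductKet).image ?_
  refine Continuous.prodMk ?_ (by fun_prop)
  have h : Continuous fun q : Ket d × Ket d => q.1.ofLp :=
    (PiLp.continuous_ofLp 2 _).comp continuous_fst
  exact h.matrix_vecMulVec h.star

/-- The averages `∑ᵢ pᵢ |⟨φᵢ|ψᵢ⟩|²` over the pure state decompositions of `ρ` and the families
of product kets. -/
def averageOverlaps (ρ : Op d) : Set ℝ := {y | (ρ, y) ∈ convexHull ℝ (overlapPairs d)}

theorem isCompact_averageOverlaps (ρ : Op d) : IsCompact (averageOverlaps ρ) := by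
  have h := ((isCompact_convexHull (isCompact_overlapPairs (d := d))).inter_right
    (isClosed_singleton.preimage continuous_fst : IsClosed (Prod.fst ⁻¹' {ρ}))).image
    continuous_snd
  convert h using 1
  ext y
  constructor
  · intro hy
    exact ⟨(ρ, y), ⟨hy, rfl⟩, rfl⟩
  · rintro ⟨⟨ρ', y'⟩, ⟨hy, rfl⟩, rfl⟩
    exact hy

theorem mem_averageOverlaps_iff {ρ : Op d} {y : ℝ} :
    y ∈ averageOverlaps ρ ↔ ∃ (k : ℕ) (p : Fin k → ℝ) (ψ φ : Fin k → Ket d),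
      IsPureDecomposition ρ p ψ ∧ (∀ i, IsProductKet (φ i)) ∧
      y = ∑ i, p i * ‖inner ℂ (φ i) (ψ i)‖ ^ 2 := by
  have hsm (r : ℝ) (A : Op d) : r • A = (r : ℂ) • A := (Complex.coe_smul r A).symm
  constructor
  · intro hy
    obtain ⟨κ, _, w, z, hw, hw1, hz, hx⟩ := mem_convexHull_iff_exists_fintype.mp hy
    choose q hq hqz using hz
    let e := (Fintype.equivFin κ).symm
    refine ⟨_, w ∘ e, fun i => (q (e i)).1, fun i => (q (e i)).2,
      ⟨fun i => hw _, by rw [← hw1]; exact e.sum_comp w,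
        fun i => by simpa using (hq (e i)).1, ?_⟩, fun i => (hq (e i)).2, ?_⟩
    · have h := congrArg Prod.fst hx
      rw [← e.sum_comp] at h
      simpa only [Prod.fst_sum, Prod.smul_fst, ← hqz, hsm, Function.comp_apply] using h.symm
    · have h := congrArg Prod.snd hx
      rw [← e.sum_comp] at h
      simpa only [Prod.snd_sum, Prod.smul_snd, ← hqz, smul_eq_mul, Function.comp_apply] using h.symm
  · rintro ⟨k, p, ψ, φ, ⟨hp, hp1, hψ, hρ⟩, hφ, rfl⟩
    refine mem_convexHull_of_exists_fintype p
      (fun i => (proj (ψ i), ‖inner ℂ (φ i) (ψ i)‖ ^ 2)) hp hp1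
      (fun i => ⟨(ψ i, φ i), ⟨by simpa using hψ i, hφ i⟩, rfl⟩) ?_
    ext1
    · simp only [Prod.fst_sum, Prod.smul_fst, hsm, hρ]
    · simp only [Prod.snd_sum, Prod.smul_snd, smul_eq_mul]

/-- Unnormalised decompositions yield average overlaps as well. -/
theorem sum_overlaps_mem_averageOverlaps {ρ : Op d} (htr : ρ.trace = 1) {a φ : ι → Ket d}
    (hρ : ρ = ∑ i, proj (a i)) (hφ : ∀ i, IsProductKet (φ i)) :
    ∑ i, ‖inner ℂ (φ i) (a i)‖ ^ 2 ∈ averageOverlaps ρ := by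
  classical
  have hex (i : ι) : ∃ ψ : Ket d, ‖ψ‖ = 1 ∧ a i = (‖a i‖ : ℂ) • ψ := by
    by_cases h : a i = 0
    -- A zero vector has no direction; any unit vector serves, with weight `0`.
    · exact ⟨φ i, (hφ i).norm_eq_one, by simp [h]⟩
    · have h' : (‖a i‖ : ℂ) ≠ 0 := by simpa using h
      refine ⟨(‖a i‖ : ℂ)⁻¹ • a i, ?_, by rw [smul_inv_smul₀ h']⟩
      rw [norm_smul, norm_inv, Complex.norm_real, norm_norm, inv_mul_cancel₀ (by simpa using h)]
  choose ψ hψ ha using hex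
  refine mem_convexHull_of_exists_fintype (fun i => ‖a i‖ ^ 2)
    (fun i => (proj (ψ i), ‖inner ℂ (φ i) (ψ i)‖ ^ 2)) (fun i => sq_nonneg _) ?_
    (fun i => ⟨(ψ i, φ i), ⟨by simpa using hψ i, hφ i⟩, rfl⟩) ?_
  · rw [hρ, Matrix.trace_sum] at htr
    simp only [trace_proj] at htr
    exact_mod_cast htr
  · ext1
    · simp only [Prod.fst_sum, Prod.smul_fst]
      rw [hρ]
      refine Finset.sum_congr rfl fun i _ => ?_
      conv_rhs => rw [ha i, proj_smul]
      rw [Complex.norm_real, norm_norm, Complex.coe_smul]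
    · simp only [Prod.snd_sum, Prod.smul_snd, smul_eq_mul]
      refine Finset.sum_congr rfl fun i _ => ?_
      conv_rhs => rw [ha i, inner_smul_right, norm_mul, mul_pow, Complex.norm_real, norm_norm]

theorem sum_proj_sqrt_smul {k : ℕ} {ρ : Op d} {p : Fin k → ℝ} {ψ : Fin k → Ket d}
    (h : IsPureDecomposition ρ p ψ) : ∑ i, proj (((√(p i) : ℝ) : ℂ) • ψ i) = ρ := by
  rw [h.2.2.2]
  refine Finset.sum_congr rfl fun i _ => ?_
  rw [proj_smul, Complex.norm_real, Real.norm_eq_abs, sq_abs, Real.sq_sqrt (h.1 i)]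

/-! ### Average overlaps against fidelities and convex roof values. -/

theorem exists_fidelity_ge {ρ : Op d} {y : ℝ} (hy : y ∈ averageOverlaps ρ) :
    ∃ σ : Op d, IsSeparable σ ∧ y ≤ fidelity ρ σ := by
  obtain ⟨k, p, ψ, φ, hdec, hφ, rfl⟩ := mem_averageOverlaps_iff.mp hy
  obtain ⟨hp, hp1, hψ, hρ⟩ := id hdec
  set y := ∑ i, p i * ‖inner ℂ (φ i) (ψ i)‖ ^ 2 with hydef
  have hterm (i : Fin k) : 0 ≤ p i * ‖inner ℂ (φ i) (ψ i)‖ ^ 2 :=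
    mul_nonneg (hp i) (sq_nonneg _)
  have hy0 : 0 ≤ y := Finset.sum_nonneg fun i _ => hterm i
  -- The weights below divide by `y`; if `y = 0`, any separable state will do.
  rcases hy0.eq_or_lt with h0 | hpos
  · exact ⟨∑ i, (p i : ℂ) • proj (φ i),
      ⟨k, p, φ, ⟨hp, hp1, fun i => (hφ i).norm_eq_one, rfl⟩, hφ⟩,
      by rw [← h0]; exact sq_nonneg _⟩
  -- Equality in Cauchy–Schwarz forces `qᵢ` proportional to `pᵢ |⟨φᵢ|ψᵢ⟩|²`. The phase in `b i`
  -- makes each `⟨aᵢ|bᵢ⟩` nonnegative, so the overlaps add up to `√y`.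
  set q : Fin k → ℝ := fun i => p i * ‖inner ℂ (φ i) (ψ i)‖ ^ 2 / y
  set a : Fin k → Ket d := fun i => ((√(p i) : ℝ) : ℂ) • ψ i
  set b : Fin k → Ket d := fun i => (((√(p i) / √y : ℝ) : ℂ) * inner ℂ (φ i) (ψ i)) • φ i
  have hb : ∑ i, (q i : ℂ) • proj (φ i) = ∑ i, proj (b i) := by
    refine Finset.sum_congr rfl fun i _ => ?_
    rw [proj_smul, norm_mul, Complex.norm_real, mul_pow, Real.norm_eq_abs, sq_abs, div_pow,
      Real.sq_sqrt (hp i), Real.sq_sqrt hy0, div_mul_eq_mul_div]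
  refine ⟨∑ i, (q i : ℂ) • proj (φ i), ⟨k, q, φ, ⟨fun i => div_nonneg (hterm i) hy0, ?_,
    fun i => (hφ i).norm_eq_one, rfl⟩, hφ⟩, ?_⟩
  · rw [← Finset.sum_div, ← hydef, div_self hpos.ne']
  · have h := re_trace_le_trace_sqrt (colMatrix a) (colMatrix b)
    rw [colMatrix_mul_conjTranspose, colMatrix_mul_conjTranspose, sum_proj_sqrt_smul hdec, ← hb,
      trace_colMatrix_mul] at h
    have hin (i : Fin k) : inner ℂ (a i) (b i) =
        ((p i * ‖inner ℂ (φ i) (ψ i)‖ ^ 2 / √y : ℝ) : ℂ) := by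
      rw [inner_smul_left, inner_smul_right, Complex.conj_ofReal, mul_assoc (_ : ℂ) (inner ℂ _ _),
        ← inner_conj_symm (ψ i) (φ i), Complex.mul_conj', ← mul_assoc]
      rw [mul_div_right_comm, ← Real.mul_self_sqrt (hp i), mul_div_assoc,
        Real.sqrt_mul_self (Real.sqrt_nonneg _)]
      push_cast
      rfl
    rw [Finset.sum_congr rfl fun i _ => hin i, ← Complex.ofReal_sum, Complex.ofReal_re,
      ← Finset.sum_div, ← hydef, Real.div_sqrt] at h
    rw [← Real.sq_sqrt hy0]
    exact pow_le_pow_left₀ (Real.sqrt_nonneg _) h 2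

theorem exists_averageOverlap_ge {ρ σ : Op d} (hρ : IsState ρ) (hσ : IsSeparable σ) :
    ∃ y ∈ averageOverlaps ρ, fidelity ρ σ ≤ y := by
  obtain ⟨k, q, φ, hdec, hφ⟩ := hσ
  obtain ⟨hq, hq1, -, -⟩ := id hdec
  obtain ⟨φ₀, hφ₀⟩ : ∃ φ₀ : Ket d, IsProductKet φ₀ := by
    rcases Nat.eq_zero_or_pos k with rfl | hk
    · simp at hq1
    · exact ⟨φ ⟨0, hk⟩, hφ _⟩
  set b : Fin k → Ket d := fun i => ((√(q i) : ℝ) : ℂ) • φ i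
  have hb : colMatrix b * (colMatrix b)ᴴ = σ := by
    rw [colMatrix_mul_conjTranspose, sum_proj_sqrt_smul hdec]
  obtain ⟨A, C, hAC, htr⟩ := exists_trace_eq_trace_sqrt hρ.1 (colMatrix b)
  set a : Fin k → Ket d := fun i => WithLp.toLp 2 fun x => A x i
  set c : Idx d → Ket d := fun l => WithLp.toLp 2 fun x => C x l
  have hA : A = colMatrix a := rfl
  have hC : C = colMatrix c := rfl
  rw [hA, hC, colMatrix_mul_conjTranspose, colMatrix_mul_conjTranspose] at hAC
  rw [hb, hA, trace_colMatrix_mul] at htr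
  -- The columns of `C` complete those of `A` to a decomposition of `ρ`; paired with `φ₀`, they only
  -- add nonnegative terms.
  refine ⟨_, sum_overlaps_mem_averageOverlaps hρ.2 (a := Sum.elim a c)
    (φ := Sum.elim φ fun _ => φ₀) ?_ ?_, ?_⟩
  · rw [Fintype.sum_sum_type]; exact hAC
  · rintro (i | l)
    · exact hφ i
    · exact hφ₀
  · rw [Fintype.sum_sum_type]
    simp only [Sum.elim_inl, Sum.elim_inr]
    refine le_add_of_le_of_nonneg ?_ (Finset.sum_nonneg fun l _ => sq_nonneg _)
    have hle : ‖∑ i, inner ℂ (a i) (b i)‖ ≤ ∑ i, √(q i) * ‖inner ℂ (φ i) (a i)‖ := by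
      refine (norm_sum_le _ _).trans (Finset.sum_le_sum fun i _ => le_of_eq ?_)
      rw [inner_smul_right, norm_mul, Complex.norm_real, Real.norm_eq_abs,
        abs_of_nonneg (Real.sqrt_nonneg _), norm_inner_symm]
    calc fidelity ρ σ = |(∑ i, inner ℂ (a i) (b i)).re| ^ 2 := by rw [fidelity, ← htr, sq_abs]
      _ ≤ (∑ i, √(q i) * ‖inner ℂ (φ i) (a i)‖) ^ 2 :=
          pow_le_pow_left₀ (abs_nonneg _) ((Complex.abs_re_le_norm _).trans hle) 2
      _ ≤ (∑ i, √(q i) ^ 2) * ∑ i, ‖inner ℂ (φ i) (a i)‖ ^ 2 :=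
          Finset.sum_mul_sq_le_sq_mul_sq _ _ _
      _ = _ := by
          rw [Finset.sum_congr rfl fun i _ => Real.sq_sqrt (hq i), hq1, one_mul]

theorem nonempty_averageOverlaps {ρ : Op d} (hρ : IsState ρ) : (averageOverlaps ρ).Nonempty := by
  have hne : Nonempty (Idx d) := by
    by_contra h
    rw [not_nonempty_iff] at h
    simpa [Matrix.trace] using hρ.2
  obtain ⟨φ, hφ⟩ := exists_isProductKet hne
  have hσ : IsSeparable (proj φ) :=
    ⟨1, fun _ => 1, fun _ => φ, ⟨by simp, by simp, fun _ => hφ.norm_eq_one, by simp⟩, fun _ => hφ⟩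
  obtain ⟨y, hy, -⟩ := exists_averageOverlap_ge hρ hσ
  exact ⟨y, hy⟩

/-- The maximal product overlap of each `ψᵢ` is attained, so closest product kets can be chosen. -/
theorem one_sub_mem_averageOverlaps {ρ : Op d} {x : ℝ} (hx : x ∈ convexRoofValues ρ) :
    1 - x ∈ averageOverlaps ρ := by
  obtain ⟨k, p, ψ, hdec, rfl⟩ := hx
  choose φ hφ hmax using fun i => (isGreatest_productOverlaps (hdec.2.2.1 i)).1
  refine mem_averageOverlaps_iff.mpr ⟨k, p, ψ, φ, hdec, hφ, ?_⟩
  simp only [geometricPure, mul_sub, mul_one, Finset.sum_sub_distrib, hdec.2.1, hmax]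
  ring

theorem exists_convexRoofValue_le {ρ : Op d} {y : ℝ} (hy : y ∈ averageOverlaps ρ) :
    ∃ x ∈ convexRoofValues ρ, x ≤ 1 - y := by
  obtain ⟨k, p, ψ, φ, hdec, hφ, rfl⟩ := mem_averageOverlaps_iff.mp hy
  refine ⟨_, ⟨k, p, ψ, hdec, rfl⟩, ?_⟩
  simp only [geometricPure, mul_sub, mul_one, Finset.sum_sub_distrib, hdec.2.1]
  refine sub_le_sub_left (Finset.sum_le_sum fun i _ => mul_le_mul_of_nonneg_left ?_ (hdec.1 i)) 1
  exact (isGreatest_productOverlaps (hdec.2.2.1 i)).2 ⟨φ i, hφ i, rfl⟩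

end Entanglement
end

/-- The first three conjuncts say that the maximum in the definition of `E_G` on pure states, the
minimum in its convex roof at `ρ`, and the maximum of the fidelity over the separable states are
attained; the last one is the equality `E_G(ρ) = 1 - max_{σ ∈ S} F(ρ, σ)`. -/
theorem proposition1 {n : ℕ} (d : Fin n → ℕ) (ρ : Entanglement.Op d)
    (hρ : Entanglement.IsState ρ) :
    (∀ ψ : Entanglement.Ket d, ‖ψ‖ = 1 →
      IsGreatest (Entanglement.productOverlaps ψ) (sSup (Entanglement.productOverlaps ψ))) ∧
    IsLeast (Entanglement.convexRoofValues ρ) (Entanglement.geometricMeasure ρ) ∧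
    IsGreatest (Entanglement.separableFidelities ρ)
      (sSup (Entanglement.separableFidelities ρ)) ∧
    Entanglement.geometricMeasure ρ = 1 - sSup (Entanglement.separableFidelities ρ) := by
  obtain ⟨y, hy, hmax⟩ := (Entanglement.isCompact_averageOverlaps ρ).exists_isGreatest
    (Entanglement.nonempty_averageOverlaps hρ)
  have hleast : IsLeast (Entanglement.convexRoofValues ρ) (1 - y) := by
    have hlow : 1 - y ∈ lowerBounds (Entanglement.convexRoofValues ρ) := fun x hx => by
      linarith [hmax (Entanglement.one_sub_mem_averageOverlaps hx)]
    obtain ⟨x, hx, hxy⟩ := Entanglement.exists_convexRoofValue_le hy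
    exact ⟨le_antisymm hxy (hlow hx) ▸ hx, hlow⟩
  have hgreatest : IsGreatest (Entanglement.separableFidelities ρ) y := by
    have hup : y ∈ upperBounds (Entanglement.separableFidelities ρ) := by
      rintro _ ⟨σ, hσ, rfl⟩
      obtain ⟨y', hy', hle⟩ := Entanglement.exists_averageOverlap_ge hρ hσ
      exact hle.trans (hmax hy')
    obtain ⟨σ, hσ, hle⟩ := Entanglement.exists_fidelity_ge hy
    exact ⟨⟨σ, hσ, le_antisymm hle (hup ⟨σ, hσ, rfl⟩)⟩, hup⟩
  have hE : Entanglement.geometricMeasure ρ = 1 - y := hleast.csInf_eq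
  rw [hE, hgreatest.csSup_eq]
  exact ⟨fun ψ hψ => Entanglement.isGreatest_productOverlaps hψ, hleast, hgreatest, rfl⟩
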